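/- Let $G=(V,E)$ be a finite connected graph (loops and parallel edges are allowed). Choose an orientation of the edges, let $\partial:\mathbb Z^{E}\to\mathbb Z^{V}$, $e\mapsto \mathrm{target}(e)-\mathrm{source}(e)$, be the boundary map, and let $L=\partial\,\partial^{\top}$ be the Laplacian. Put $\mathrm{Div}(G)=\mathbb Z^{V}$, $\mathrm{Prin}(G)=\operatorname{im}(L)$, $\mathrm{Jac}(G)=\mathrm{Div}(G)/\mathrm{Prin}(G)$, let $\deg:\mathrm{Div}(G)\to\mathbb Z$ be the sum of the coordinates, and let $$D_{\mathrm{div}}(G)=\bigl[\,\mathrm{Prin}(G)\hookrightarrow \mathrm{Div}(G)\xrightarrow{\ \deg\ }\mathbb Z\,\bigr]$$ be the cone complex of $G$ in its divisor form, a cochain complex with terms in degrees $-1,0,1$. Let $\mathbf D=\mathbf R\!\operatorname{Hom}_{\mathbb Z}(-,\mathbb Z)$ be the derived dual, and let $\tau(G)$ be the number of spanning trees of $G$. Then $$H^1\mathbf D\bigl(D_{\mathrm{div}}(G)\bigr)\;\cong\;\operatorname{tors}\mathrm{Jac}(G),$$ and $$|H^1\mathbf D(D_{\mathrm{div}}(G))|=|\operatorname{tors}\mathrm{Jac}(G)|=|\operatorname{tors}\operatorname{coker}(L)|=\det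 L_{vv}=\tau(G)$$ for every vertex $v$, where $L_{vv}$ is the reduced Laplacian, i.e. $L$ with the row and the column of $v$ deleted. More generally, every cofactor of $L$ (that is, $(-1)^{i+j}$ times the determinant of $L$ with the $i$-th row and the $j$-th column deleted) equals $\tau(G)$. All this holds for every choice of the orientation. -/

import Mathlib

open CategoryTheory
open scoped Graph

namespace GraphJacobian

noncomputable section

/-- A choice of orientation of the edges of a multigraph: a source and a target for every edge. -/
structure Orientation {α β : Type} (G : Graph α β) where
  /-- the source of an edge -/
  src : E(G) → V(G)
  /-- the target of an edge -/
  tgt : E(G) → V(G)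
  /-- the source and the target are the two ends of the edge -/
  isLink : ∀ e : E(G), G.IsLink (e : β) (src e : α) (tgt e : α)

/-- A multigraph is connected if it has a vertex and any two of its vertices are joined by a walk.
(Loops and parallel edges play no role, so one can look at the underlying simple graph.) -/
def IsConnected {α β : Type} (G : Graph α β) : Prop :=
  G.toSimpleGraph.Connected

/-- A multigraph is a tree if it has no loops and no parallel edges and the underlying simple
graph is connected and acyclic. -/
def IsTree {α β : Type} (T : Graph α β) : Prop :=
  T.Simple ∧ T.toSimpleGraph.IsTree

/-- The number `τ(G)` of spanning trees of `G`: subgraphs of `G` on all vertices of `G`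
that are trees. -/
def numSpanningTrees {α β : Type} (G : Graph α β) : ℕ :=
  Nat.card {T : Graph α β // T.IsSpanningSubgraph G ∧ IsTree T}

section Laplacian

variable {α β : Type} [DecidableEq α] {G : Graph α β} [Fintype V(G)] [Fintype E(G)]

/-- The matrix of the boundary map `∂ : ℤ^E → ℤ^V`, `e ↦ tgt e - src e`. -/
def boundary (o : Orientation G) : Matrix V(G) E(G) ℤ :=
  Matrix.of fun v e => (if o.tgt e = v then 1 else 0) - (if o.src e = v then 1 else 0)

/-- The Laplacian `L = ∂ ∂ᵀ`. -/
def laplacian (o : Orientation G) : Matrix V(G) V(G) ℤ :=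
  boundary o * (boundary o).transpose

/-- The Laplacian with the row and the column of the vertex `v` deleted. -/
def reducedLaplacian (o : Orientation G) (v : V(G)) :
    Matrix {u : V(G) // u ≠ v} {u : V(G) // u ≠ v} ℤ :=
  (laplacian o).submatrix Subtype.val Subtype.val

variable (G) in
/-- The group `Div(G) = ℤ^V` of divisors. -/
abbrev Div : Type := V(G) → ℤ

/-- The group `Prin(G) = im L` of principal divisors. -/
abbrev Prin (o : Orientation G) : Submodule ℤ (Div G) :=
  LinearMap.range (laplacian o).mulVecLin

/-- The Jacobian `Jac(G) = Div(G) / Prin(G)`. -/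
abbrev Jac (o : Orientation G) : Type := Div G ⧸ Prin o

variable (G) in
/-- The degree map `deg : Div(G) → ℤ`, the sum of the coordinates. -/
def deg : Div G →ₗ[ℤ] ℤ :=
  ∑ v : V(G), LinearMap.proj v

theorem deg_laplacian (o : Orientation G) (x : Div G) :
    deg G ((laplacian o).mulVec x) = 0 := by
  have h : Matrix.vecMul (1 : V(G) → ℤ) (boundary o) = 0 := by
    ext e
    simp [Matrix.vecMul, dotProduct, boundary]
  have h2 : deg G ((laplacian o).mulVec x) = dotProduct 1 ((laplacian o).mulVec x) := by
    simp [deg, dotProduct]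
  rw [h2, Matrix.dotProduct_mulVec, laplacian, ← Matrix.vecMul_vecMul, h]
  simp

theorem deg_comp_subtype (o : Orientation G) : deg G ∘ₗ (Prin o).subtype = 0 := by
  ext ⟨_, x, rfl⟩
  exact deg_laplacian o x

/-- The terms of the complex `Prin(G) → Div(G) → ℤ`, in the cohomological degrees `-1, 0, 1`. -/
def divisorComplexX (o : Orientation G) : ℤ → ModuleCat.{0} ℤ
  | Int.negSucc 0 => ModuleCat.of ℤ (Prin o)
  | Int.ofNat 0 => ModuleCat.of ℤ (Div G)
  | Int.ofNat 1 => ModuleCat.of ℤ ℤ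
  | _ => ModuleCat.of ℤ PUnit

/-- The differentials of the complex `Prin(G) → Div(G) → ℤ`: the inclusion and the degree map. -/
def divisorComplexD (o : Orientation G) :
    (n : ℤ) → (divisorComplexX o n ⟶ divisorComplexX o (n + 1))
  | Int.negSucc 0 => ModuleCat.ofHom (Prin o).subtype
  | Int.ofNat 0 => ModuleCat.ofHom (deg G)
  | Int.ofNat (_ + 1) => 0
  | Int.negSucc (_ + 1) => 0

theorem divisorComplexD_comp (o : Orientation G) (n : ℤ) :
    divisorComplexD o n ≫ divisorComplexD o (n + 1) = 0 := by
  match n with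
  | Int.negSucc 0 =>
    exact (ModuleCat.ofHom_comp _ _).symm.trans
      (congrArg ModuleCat.ofHom (deg_comp_subtype o))
  | Int.ofNat 0 =>
    exact Limits.comp_zero
  | Int.ofNat (_ + 1) => exact Limits.zero_comp
  | Int.negSucc (_ + 1) => exact Limits.zero_comp

/-- The divisor form `Prin(G) ↪ Div(G) → ℤ` of the cone complex of `G`, a cochain complex of
abelian groups with `Prin(G)` in degree `-1`, `Div(G)` in degree `0` and `ℤ` in degree `1`. -/
def divisorComplex (o : Orientation G) : CochainComplex (ModuleCat.{0} ℤ) ℤ :=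
  CochainComplex.of (divisorComplexX o) (divisorComplexD o) (divisorComplexD_comp o)

end Laplacian

/-- The derived dual `RHom(K, ℤ)` of a complex `K` of abelian groups, computed by an injective
resolution `R` of `ℤ`: the total complex of homomorphisms from `K` to `R`. -/
def derivedDual (R : InjectiveResolution (ModuleCat.of ℤ ℤ))
    (K : CochainComplex (ModuleCat.{0} ℤ) ℤ) : CochainComplex AddCommGrpCat ℤ :=
  CochainComplex.HomComplex K R.cochainComplex

end

end GraphJacobian

/-! In the divisor complex the terms in degrees 0 and 1 are free and an injective resolution `R` of
`ℤ` is exact in positive degrees. Every degree 1 class of `Hom(K, R)` can therefore be pushed down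
to `K⁻¹`, which gives `H¹ = coker(Div* → Prin*)` (`homologyOneEquiv`). Smith normal form identifies
this cokernel with `tors(Div / Prin)`, non-canonically (`nonempty_quotient_dual_equiv_torsion`).

Since `G` is connected, `y·Ly = |∂ᵀy|²` shows that `ker L` consists of the constants. Hence `tors
Jac` is the group of classes of degree zero, and forgetting the coordinate at `v` turns it into the
cokernel of the reduced Laplacian, of order `|det L_vv|` (`nat_card_torsion_jac`). The same kernel
makes the adjugate of `L` constant along columns, and symmetry makes all cofactors equal.

Finally `L_vv = A Aᵀ`, with `A` the boundary matrix without row `v`. Cauchy-Binet writes `det L_vv`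
as the sum of the squares of the maximal minors of `A`; a minor is `±1` if its edges connect the
graph, that is, form a spanning tree, and `0` otherwise (`det_reducedLaplacian`). -/

namespace CategoryTheory.InjectiveResolution

/-! ### Lifting through an injective resolution -/

open Limits CochainComplex.HomComplex

universe v u

variable {C : Type u} [Category.{v} C] [Abelian C] {A : C} (R : InjectiveResolution A)

theorem exists_comp_cochainComplex_d_eq {P : C} [Projective P] (n : ℕ) {p q r : ℤ}
    (hp : (n : ℤ) = p) (hq : ((n + 1 : ℕ) : ℤ) = q) (hr : ((n + 2 : ℕ) : ℤ) = r)
    (f : P ⟶ R.cochainComplex.X q) (hf : f ≫ R.cochainComplex.d q r = 0) :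
    ∃ g : P ⟶ R.cochainComplex.X p, g ≫ R.cochainComplex.d p q = f := by
  have hf' : (f ≫ (R.cochainComplexXIso q (n + 1) hq).hom) ≫ R.cocomplex.d (n + 1) (n + 2) = 0 := by
    rw [R.cochainComplex_d _ _ _ _ hq hr] at hf
    rw [← cancel_mono (R.cochainComplexXIso r (n + 2) hr).inv]
    simpa using hf
  refine ⟨(R.exact_succ n).liftFromProjective _ hf' ≫ (R.cochainComplexXIso p n hp).inv, ?_⟩
  have h := (R.exact_succ n).liftFromProjective_comp _ hf'
  dsimp at h
  rw [R.cochainComplex_d _ _ _ _ hp hq]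
  simp [reassoc_of% h]

/-- The augmentation `A ⟶ R⁰` of an injective resolution. -/
noncomputable def augmentation₀ : A ⟶ R.cocomplex.X 0 := R.ι.f 0

instance : Mono R.augmentation₀ :=
  mono_of_isLimit_fork R.isLimitKernelFork

theorem augmentation₀_d : R.augmentation₀ ≫ R.cocomplex.d 0 1 = 0 :=
  R.ι_f_zero_comp_complex_d

theorem exact_augmentation₀ : (ShortComplex.mk _ _ R.augmentation₀_d).Exact :=
  R.exact₀

/-- The augmentation `A ⟶ R⁰` of an injective resolution, with values in the cochain complex
indexed by `ℤ`. -/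
noncomputable def augmentation : A ⟶ R.cochainComplex.X 0 :=
  R.augmentation₀ ≫ (R.cochainComplexXIso 0 0 rfl).inv

instance : Mono R.augmentation :=
  mono_comp _ _

theorem augmentation_d (q : ℤ) : R.augmentation ≫ R.cochainComplex.d 0 q = 0 := by
  by_cases hq : 0 + 1 = q
  · rw [R.cochainComplex_d 0 q 0 1 rfl (by simpa using hq)]
    simp [augmentation, reassoc_of% R.augmentation₀_d]
  · rw [R.cochainComplex.shape _ _ hq, comp_zero]

/-- `A` is the kernel of `R⁰ → R¹`, so in degree 0 no projectivity of `P` is needed. -/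
theorem exists_comp_augmentation_eq {P : C} (f : P ⟶ R.cochainComplex.X 0)
    (hf : f ≫ R.cochainComplex.d 0 1 = 0) : ∃ g : P ⟶ A, g ≫ R.augmentation = f := by
  have hf' : (f ≫ (R.cochainComplexXIso 0 0 rfl).hom) ≫ R.cocomplex.d 0 1 = 0 := by
    rw [R.cochainComplex_d 0 1 0 1 rfl rfl] at hf
    rw [← cancel_mono (R.cochainComplexXIso 1 1 rfl).inv]
    simpa using hf
  have hm : Mono (ShortComplex.mk _ _ R.augmentation₀_d).f := by
    dsimp; infer_instance
  refine ⟨R.exact_augmentation₀.lift _ hf', ?_⟩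
  have h := R.exact_augmentation₀.lift_f _ hf'
  dsimp at h
  simp [augmentation, reassoc_of% h]

end CategoryTheory.InjectiveResolution

/-! ### First cohomology of `Hom(K, R)` for `K` in degrees -1, 0, 1 -/

namespace CochainComplex.HomComplex

open CategoryTheory Limits

universe v u

variable {C : Type u} [Category.{v} C] [Abelian C] {A : C} (R : InjectiveResolution A)
  (K : CochainComplex C ℤ)

section

variable [K.IsStrictlyGE (-1)]

theorem δ_single_augmentation (f : K.X (-1) ⟶ A) :
    δ 1 2 (Cochain.single (f ≫ R.augmentation) 1 : Cochain K R.cochainComplex 1) = 0 := by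
  have h0 : K.d (-2) (-1) = 0 :=
    (CochainComplex.isZero_of_isStrictlyGE K (-1) (-2) (by lia)).eq_of_src _ _
  rw [Cochain.δ_single _ 1 2 rfl (-2) 1 (by lia) (by lia), h0]
  simp [R.augmentation_d]

/-- The cohomology classes of degree `1` of `Hom(K, R)` that come from the bottom term of `K`. -/
noncomputable def classOfBottom :
    (K.X (-1) ⟶ A) →+ CohomologyClass K R.cochainComplex 1 where
  toFun f := CohomologyClass.mk (Cocycle.mk (Cochain.single (f ≫ R.augmentation) 1) 2 rfl
    (δ_single_augmentation R K f))
  map_zero' := by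
    rw [CohomologyClass.mk_eq_zero_iff]
    convert (coboundaries K R.cochainComplex 1).zero_mem
    ext : 1
    simp
  map_add' f g := by
    rw [← CohomologyClass.mk_add]
    congr 1
    ext p q hpq
    by_cases hp : p = -1
    · subst hp
      obtain rfl : q = 0 := by lia
      simp
    · simp [Cochain.single_v_eq_zero _ _ _ _ _ hp]

variable {R K} in
theorem classOfBottom_eq_zero_of_eq_comp (g : K.X 0 ⟶ A) :
    classOfBottom R K (K.d (-1) 0 ≫ g) = 0 := by
  refine (CohomologyClass.mk_eq_zero_iff _).2 ((mem_coboundaries_iff (n := 1) _ 0 (by lia)).2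
    ⟨-Cochain.single (g ≫ R.augmentation) 0, ?_⟩)
  rw [δ_neg, Cochain.δ_single _ 0 1 (by lia) (-1) 1 (by lia) (by lia)]
  simp [R.augmentation_d]

end

variable {K}

theorem exists_eq_comp_of_classOfBottom_eq_zero [K.IsStrictlyGE (-1)] [K.IsStrictlyLE 1]
    [Projective (K.X 1)] (f : K.X (-1) ⟶ A) (hf : classOfBottom R K f = 0) :
    ∃ g : K.X 0 ⟶ A, K.d (-1) 0 ≫ g = f := by
  obtain ⟨h, hh⟩ := (mem_coboundaries_iff (n := 1) _ 0 (by lia)).1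
    ((CohomologyClass.mk_eq_zero_iff _).1 hf)
  simp only [Cocycle.mk_coe] at hh
  have h₀ : h.v (-1) (-1) (by lia) = 0 :=
    (CochainComplex.isZero_of_isStrictlyGE R.cochainComplex 0 (-1) (by lia)).eq_of_tgt _ _
  have h₁ : K.d 1 2 = 0 :=
    (CochainComplex.isZero_of_isStrictlyLE K 1 2 (by lia)).eq_of_tgt _ _
  have e₀ := Cochain.congr_v hh (-1) 0 (by lia)
  have e₁ := Cochain.congr_v hh 0 1 (by lia)
  have e₂ := Cochain.congr_v hh 1 2 (by lia)
  rw [δ_v 0 1 (by lia) h (-1) 0 (by lia) (-1) 0 (by lia) (by lia), h₀] at e₀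
  rw [δ_v 0 1 (by lia) h 0 1 (by lia) 0 1 (by lia) (by lia),
    Cochain.single_v_eq_zero _ _ _ _ _ (by lia)] at e₁
  rw [δ_v 0 1 (by lia) h 1 2 (by lia) 1 2 (by lia) (by lia), h₁,
    Cochain.single_v_eq_zero _ _ _ _ _ (by lia)] at e₂
  simp at e₀ e₁ e₂
  -- Correcting `h` by a lift `k` of its component on `K¹` makes the component on `K⁰` a map into
  -- the kernel of `R⁰ → R¹`, hence into `A`. The correction dies on `K⁻¹` because `d ≫ d = 0`.
  obtain ⟨k, hk⟩ := R.exists_comp_cochainComplex_d_eq 0 (p := 0) (q := 1) (r := 2) rfl rfl rfl _ e₂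
  obtain ⟨g, hg⟩ := R.exists_comp_augmentation_eq (h.v 0 0 (by lia) - K.d 0 1 ≫ k) (by
    rw [Preadditive.sub_comp, Category.assoc, hk, sub_eq_add_neg]
    exact e₁)
  refine ⟨-g, ?_⟩
  rw [← cancel_mono R.augmentation, ← e₀]
  simp [hg]

/-- The components of a cocycle on `K¹` and then on `K⁰` are lifted through `R` and removed by
coboundaries. What remains lives on `K⁻¹` and lands in `ker(R⁰ → R¹) = A`, so `K⁻¹` need not be
projective. -/
theorem classOfBottom_surjective [K.IsStrictlyGE (-1)] [K.IsStrictlyLE 1] [Projective (K.X 0)]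
    [Projective (K.X 1)] : Function.Surjective (classOfBottom R K) := by
  intro z
  obtain ⟨z, rfl⟩ := z.mk_surjective
  have hz := Cocycle.δ_eq_zero z 2
  have h₁ : K.d 1 2 = 0 :=
    (CochainComplex.isZero_of_isStrictlyLE K 1 2 (by lia)).eq_of_tgt _ _
  have e₀ := Cochain.congr_v hz (-1) 1 (by lia)
  have e₁ := Cochain.congr_v hz 0 2 (by lia)
  have e₂ := Cochain.congr_v hz 1 3 (by lia)
  rw [δ_v 1 2 (by lia) _ (-1) 1 (by lia) 0 0 (by lia) (by lia)] at e₀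
  rw [δ_v 1 2 (by lia) _ 0 2 (by lia) 1 1 (by lia) (by lia)] at e₁
  rw [δ_v 1 2 (by lia) _ 1 3 (by lia) 2 2 (by lia) (by lia), h₁] at e₂
  simp [Int.negOnePow_even 2 even_two] at e₀ e₁ e₂
  obtain ⟨k₁, hk₁⟩ := R.exists_comp_cochainComplex_d_eq 1 (p := 1) (q := 2) (r := 3)
    rfl rfl rfl _ e₂
  obtain ⟨k₀, hk₀⟩ := R.exists_comp_cochainComplex_d_eq 0 (p := 0) (q := 1) (r := 2) rfl rfl rfl
    ((z : Cochain K R.cochainComplex 1).v 0 1 (by lia) + K.d 0 1 ≫ k₁) (by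
      rw [Preadditive.add_comp, Category.assoc, hk₁]
      exact e₁)
  obtain ⟨f, hf⟩ := R.exists_comp_augmentation_eq
    ((z : Cochain K R.cochainComplex 1).v (-1) 0 (by lia) + K.d (-1) 0 ≫ k₀) (by
      rw [Preadditive.add_comp, Category.assoc, hk₀]
      simpa using e₀)
  refine ⟨f, ?_⟩
  rw [eq_comm, ← sub_eq_zero]
  refine (CohomologyClass.mk_eq_zero_iff (z - Cocycle.mk (Cochain.single (f ≫ R.augmentation) 1)
    2 rfl (δ_single_augmentation R K f))).2 ((mem_coboundaries_iff (n := 1) _ 0 (by lia)).2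
    ⟨Cochain.single k₀ 0 + Cochain.single k₁ 0, ?_⟩)
  rw [δ_add, Cochain.δ_single _ 0 1 (by lia) (-1) 1 (by lia) (by lia),
    Cochain.δ_single _ 0 1 (by lia) 0 2 (by lia) (by lia), hk₀, hk₁]
  ext p q hpq
  by_cases hp : p < -1
  · exact (CochainComplex.isZero_of_isStrictlyGE K (-1) p hp).eq_of_src _ _
  by_cases hp' : 1 < p
  · exact (CochainComplex.isZero_of_isStrictlyLE K 1 p hp').eq_of_src _ _
  obtain rfl | rfl | rfl : p = -1 ∨ p = 0 ∨ p = 1 := by lia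
  · obtain rfl : q = 0 := by lia
    simp [Cochain.single_v_eq_zero, hf]
  · obtain rfl : q = 1 := by lia
    simp [Cochain.single_v_eq_zero]
  · obtain rfl : q = 2 := by lia
    simp [Cochain.single_v_eq_zero]

/-- If the terms of `K` are projective in the degrees `0` and `1`, and `K` lives in the degrees
`-1, 0, 1`, then the first cohomology of `Hom(K, R)` is the cokernel of
`Hom(K⁰, A) → Hom(K⁻¹, A)`. -/
noncomputable def homologyOneEquiv [K.IsStrictlyGE (-1)] [K.IsStrictlyLE 1] [Projective (K.X 0)]
    [Projective (K.X 1)] :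
    (CochainComplex.HomComplex K R.cochainComplex).homology 1 ≃+
      (K.X (-1) ⟶ A) ⧸ (Preadditive.leftComp A (K.d (-1) 0)).range :=
  (homologyAddEquiv K R.cochainComplex 1).trans
    ((QuotientAddGroup.quotientAddEquivOfEq (by
      ext f
      rw [AddMonoidHom.mem_ker]
      refine ⟨fun ⟨g, hg⟩ ↦ hg ▸ classOfBottom_eq_zero_of_eq_comp g, fun hf ↦ ?_⟩
      exact exists_eq_comp_of_classOfBottom_eq_zero R f hf)).trans
    (QuotientAddGroup.quotientKerEquivOfSurjective _ (classOfBottom_surjective R))).symm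

end CochainComplex.HomComplex

/-! ### The cokernel of `M* → N*` by Smith normal form -/

section DualCokernel

variable {M : Type*} [AddCommGroup M] {N : Submodule ℤ M}

namespace Module.Basis.SmithNormalForm

variable {ι : Type*} {n : ℕ} (S : SmithNormalForm N ι n)

/-- The map `N* → M/N` which sends the dual basis of a Smith normal form of `N ⊆ M` to the
classes of the corresponding basis vectors of `M`. -/
noncomputable def dualToQuotient : (N →ₗ[ℤ] ℤ) →+ M ⧸ N where
  toFun φ := N.mkQ (∑ j, φ (S.bN j) • S.bM (S.f j))
  map_zero' := by simp
  map_add' φ ψ := by simp only [LinearMap.add_apply, add_smul, Finset.sum_add_distrib, map_add]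

theorem a_ne_zero (j : Fin n) : S.a j ≠ 0 := by
  intro h
  apply S.bN.ne_zero j
  ext
  simp [S.snf, h]

theorem repr_sum_smul (c : Fin n → ℤ) (j : Fin n) :
    S.bM.repr (∑ j, c j • S.bM (S.f j)) (S.f j) = c j := by
  classical
  simp [Finsupp.single_apply]

theorem sum_smul_mem_iff (c : Fin n → ℤ) :
    ∑ j, c j • S.bM (S.f j) ∈ N ↔ ∀ j, S.a j ∣ c j := by
  constructor
  · intro h j
    have h1 := S.repr_apply_embedding_eq_repr_smul (m := ⟨_, h⟩) (i := j)
    rw [S.repr_sum_smul, map_smul] at h1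
    exact ⟨_, h1⟩
  · intro h
    refine N.sum_mem fun j _ ↦ ?_
    obtain ⟨d, hd⟩ := h j
    rw [hd, mul_comm, mul_smul, ← S.snf]
    exact N.smul_mem _ (S.bN j).2

/-- As `bN j = a j • bM (f j)`, a functional on `N` extends to `M` exactly when `a j` divides its
value on `bN j` for all `j`. By `sum_smul_mem_iff` this is the same as the sum lying in `N`. -/
theorem dualToQuotient_eq_zero_iff (φ : N →ₗ[ℤ] ℤ) :
    S.dualToQuotient φ = 0 ↔ ∃ ψ : M →ₗ[ℤ] ℤ, ψ ∘ₗ N.subtype = φ := by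
  have h : S.dualToQuotient φ = 0 ↔ ∑ j, φ (S.bN j) • S.bM (S.f j) ∈ N :=
    Submodule.Quotient.mk_eq_zero N
  rw [h, S.sum_smul_mem_iff]
  constructor
  · intro h
    choose d hd using h
    refine ⟨S.bM.constr ℤ (Function.extend S.f d 0), S.bN.ext fun j ↦ ?_⟩
    simp [S.snf, hd, S.f.injective.extend_apply]
  · rintro ⟨ψ, rfl⟩ j
    exact ⟨ψ (S.bM (S.f j)), by simp [S.snf]⟩

theorem range_dualToQuotient :
    S.dualToQuotient.range = AddCommGroup.torsion (M ⧸ N) := by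
  ext x
  constructor
  · rintro ⟨φ, rfl⟩
    refine isOfFinAddOrder_iff_zsmul_eq_zero.2
      ⟨∏ j, S.a j, Finset.prod_ne_zero_iff.2 fun j _ ↦ S.a_ne_zero j, ?_⟩
    rw [← map_zsmul]
    refine (Submodule.Quotient.mk_eq_zero N).2 ((S.sum_smul_mem_iff _).2 fun j ↦ ?_)
    exact Dvd.dvd.mul_right (Finset.dvd_prod_of_mem _ (Finset.mem_univ j)) _
  · intro hx
    obtain ⟨k, hk, hx⟩ := isOfFinAddOrder_iff_zsmul_eq_zero.1 hx
    obtain ⟨m, rfl⟩ := N.mkQ_surjective x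
    rw [← map_zsmul] at hx
    have hm : k • m ∈ N := (Submodule.Quotient.mk_eq_zero N).1 hx
    -- The functional reads off the coordinates of `m` along `f`; the others vanish because `k • m ∈
    -- N` and `k ≠ 0`.
    refine ⟨S.bN.constr ℤ fun j ↦ S.bM.repr m (S.f j), congrArg N.mkQ (S.bM.ext_elem fun i ↦ ?_)⟩
    by_cases hi : i ∈ Set.range S.f
    · obtain ⟨j, rfl⟩ := hi
      rw [S.repr_sum_smul]
      simp
    · have h0 : S.bM.repr m i = 0 := by
        simpa [hk] using S.repr_eq_zero_of_notMem_range ⟨_, hm⟩ hi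
      have h1 : ∀ j, S.f j ≠ i := fun j hj ↦ hi ⟨j, hj⟩
      simp [h0, h1]

end Module.Basis.SmithNormalForm

/-- For a subgroup `N` of a finitely generated free abelian group `M`, the cokernel of the
restriction `M* → N*` is isomorphic to the torsion subgroup of `M/N`. -/
theorem nonempty_quotient_dual_equiv_torsion [Module.Free ℤ M] [Module.Finite ℤ M]
    {H : Type*} [AddCommGroup H] (e : H ≃+ (N →ₗ[ℤ] ℤ)) (B : AddSubgroup H)
    (hB : ∀ h, h ∈ B ↔ ∃ ψ : M →ₗ[ℤ] ℤ, ψ ∘ₗ N.subtype = e h) :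
    Nonempty (H ⧸ B ≃+ AddCommGroup.torsion (M ⧸ N)) := by
  obtain ⟨n, S⟩ := N.smithNormalForm (Module.Free.chooseBasis ℤ M)
  let Φ : H →+ M ⧸ N := S.dualToQuotient.comp e.toAddMonoidHom
  have hker : B = Φ.ker := by
    ext h
    rw [hB, AddMonoidHom.mem_ker, ← S.dualToQuotient_eq_zero_iff]
    rfl
  have hrange : Φ.range = AddCommGroup.torsion (M ⧸ N) := by
    rw [← S.range_dualToQuotient]
    ext x
    exact (e.surjective.exists (p := fun φ ↦ S.dualToQuotient φ = x)).symm
  exact ⟨(QuotientAddGroup.quotientAddEquivOfEq hker).trans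
    ((QuotientAddGroup.quotientKerEquivRange Φ).trans (AddEquiv.addSubgroupCongr hrange))⟩

end DualCokernel

/-! ### Duality for the divisor complex -/

namespace GraphJacobian

variable {α β : Type} [DecidableEq α] {G : Graph α β} [Fintype V(G)] [Fintype E(G)]

open Limits

instance (o : Orientation G) : (divisorComplex o).IsStrictlyGE (-1) := by
  rw [CochainComplex.isStrictlyGE_iff]
  intro i hi
  match i with
  | Int.ofNat n => lia
  | Int.negSucc 0 => lia
  | Int.negSucc (n + 1) => exact ModuleCat.isZero_of_subsingleton (ModuleCat.of ℤ PUnit)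

instance (o : Orientation G) : (divisorComplex o).IsStrictlyLE 1 := by
  rw [CochainComplex.isStrictlyLE_iff]
  intro i hi
  match i with
  | Int.ofNat 0 => simp at hi
  | Int.ofNat 1 => simp at hi
  | Int.ofNat (n + 2) => exact ModuleCat.isZero_of_subsingleton (ModuleCat.of ℤ PUnit)
  | Int.negSucc n => lia

instance (o : Orientation G) : Projective ((divisorComplex o).X 0) :=
  inferInstanceAs (Projective (ModuleCat.of ℤ (Div G)))

instance (o : Orientation G) : Projective ((divisorComplex o).X 1) :=
  inferInstanceAs (Projective (ModuleCat.of ℤ ℤ))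

theorem divisorComplex_d (o : Orientation G) :
    (divisorComplex o).d (-1) 0 = ModuleCat.ofHom (Prin o).subtype :=
  CochainComplex.of_d (divisorComplexX o) (divisorComplexD o) (-1)

theorem nonempty_homology_derivedDual_equiv (o : Orientation G)
    (R : InjectiveResolution (ModuleCat.of ℤ ℤ)) :
    Nonempty ((derivedDual R (divisorComplex o)).homology 1 ≃+ AddCommGroup.torsion (Jac o)) := by
  let e : ((divisorComplex o).X (-1) ⟶ ModuleCat.of ℤ ℤ) ≃+ (Prin o →ₗ[ℤ] ℤ) :=
    ModuleCat.homAddEquiv (M := ModuleCat.of ℤ (Prin o)) (N := ModuleCat.of ℤ ℤ)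
  obtain ⟨f⟩ := nonempty_quotient_dual_equiv_torsion (N := Prin o) e
    (Preadditive.leftComp (ModuleCat.of ℤ ℤ) ((divisorComplex o).d (-1) 0)).range (by
      intro h
      rw [divisorComplex_d]
      constructor
      · rintro ⟨g, rfl⟩
        exact ⟨g.hom, rfl⟩
      · rintro ⟨ψ, hψ⟩
        refine ⟨ModuleCat.ofHom ψ, e.injective ?_⟩
        rw [← hψ]
        rfl)
  exact ⟨(CochainComplex.HomComplex.homologyOneEquiv R).trans f⟩

end GraphJacobian

/-! ### Torsion of the Jacobian, the reduced Laplacian and cofactors -/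

namespace Matrix

theorem nat_card_quotient_range_mulVecLin {n : Type*} [Fintype n] [DecidableEq n]
    (M : Matrix n n ℤ) (hM : M.det ≠ 0) :
    Nat.card ((n → ℤ) ⧸ LinearMap.range M.mulVecLin) = M.det.natAbs := by
  have hinj : Function.Injective M.mulVecLin := Matrix.mulVec_injective_of_det_ne_zero hM
  let e := LinearEquiv.ofInjective M.mulVecLin hinj
  have h := Submodule.natAbs_det_equiv (LinearMap.range M.mulVecLin) e
  have h2 : (LinearMap.range M.mulVecLin).subtype ∘ₗ AddMonoidHom.toIntLinearMap
      (e : (n → ℤ) →+ LinearMap.range M.mulVecLin) = Matrix.toLin' M := rfl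
  rw [h2, LinearMap.det_toLin'] at h
  exact h.symm

end Matrix

namespace GraphJacobian

open Matrix

section

variable {α β : Type} {G : Graph α β}

theorem eq_of_forall_src_eq_tgt (o : Orientation G) (hG : IsConnected G) {y : Div G}
    (h : ∀ e, y (o.tgt e) = y (o.src e)) (u v : V(G)) : y u = y v := by
  obtain ⟨p⟩ := hG.preconnected u v
  induction p with
  | nil => rfl
  | cons hadj _ ih =>
    rw [← ih]
    obtain ⟨e, he⟩ := hadj.2
    have h1 := h ⟨e, he.edge_mem⟩
    obtain ⟨h2, h3⟩ | ⟨h2, h3⟩ := (o.isLink ⟨e, he.edge_mem⟩).eq_and_eq_or_eq_and_eq he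
    · rw [Subtype.ext h2, Subtype.ext h3] at h1
      exact h1.symm
    · rw [Subtype.ext h2, Subtype.ext h3] at h1
      exact h1

theorem isSymm_laplacian [DecidableEq α] [Fintype E(G)] (o : Orientation G) :
    (laplacian o).IsSymm := by
  simp [Matrix.IsSymm, laplacian]

variable [Fintype V(G)]

theorem deg_apply (D : Div G) : deg G D = ∑ v, D v := by
  simp [deg]

theorem boundary_transpose_mulVec [DecidableEq α] (o : Orientation G) (y : Div G) (e : E(G)) :
    ((boundary o)ᵀ *ᵥ y) e = y (o.tgt e) - y (o.src e) := by
  simp [mulVec, dotProduct, boundary, sub_mul]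

variable [DecidableEq α]

/-- The divisor of degree zero with prescribed values outside the vertex `v`. -/
def extendDegZero (v : V(G)) : ({u : V(G) // u ≠ v} → ℤ) →ₗ[ℤ] Div G where
  toFun x u := if h : u ≠ v then x ⟨u, h⟩ else -∑ w, x w
  map_add' x y := by
    ext u
    by_cases h : u = v <;> simp [h, Finset.sum_add_distrib, add_comm]
  map_smul' c x := by
    ext u
    by_cases h : u = v <;> simp [h, Finset.mul_sum]

theorem extendDegZero_apply (v : V(G)) (x : {u : V(G) // u ≠ v} → ℤ) (u : {u : V(G) // u ≠ v}) :
    extendDegZero v x u = x u := by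
  simp [extendDegZero, u.2]

theorem deg_extendDegZero (v : V(G)) (x : {u : V(G) // u ≠ v} → ℤ) :
    deg G (extendDegZero v x) = 0 := by
  rw [deg_apply, Fintype.sum_eq_add_sum_subtype_ne _ v]
  simp only [extendDegZero_apply]
  simp [extendDegZero]

/-- Lets equations between divisors of equal degree be checked away from `v`, which is why row `v`
of `L` can be dropped. -/
theorem eq_of_deg_eq {D D' : Div G} (v : V(G)) (hdeg : deg G D = deg G D')
    (h : ∀ u : {u : V(G) // u ≠ v}, D u = D' u) : D = D' := by
  rw [deg_apply, deg_apply, Fintype.sum_eq_add_sum_subtype_ne _ v,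
    Fintype.sum_eq_add_sum_subtype_ne D' v, Fintype.sum_congr _ _ h] at hdeg
  ext u
  by_cases hu : u = v
  · subst hu
    exact add_right_cancel hdeg
  · exact h ⟨u, hu⟩

end

variable {α β : Type} [DecidableEq α] {G : Graph α β} [Fintype V(G)] [Fintype E(G)]
  (o : Orientation G)

theorem laplacian_mulVec_one : laplacian o *ᵥ 1 = 0 := by
  rw [laplacian, ← mulVec_mulVec]
  have h : (boundary o)ᵀ *ᵥ 1 = 0 := by
    ext e
    simp [boundary_transpose_mulVec]
  rw [h, mulVec_zero]

/-- `Ly = 0` forces `|∂ᵀy|² = y·Ly = 0`, so `y` agrees at the two ends of every edge. -/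
theorem eq_of_laplacian_mulVec_eq_zero (hG : IsConnected G) {y : Div G}
    (h : laplacian o *ᵥ y = 0) (u v : V(G)) : y u = y v := by
  have h1 : ((boundary o)ᵀ *ᵥ y) ⬝ᵥ ((boundary o)ᵀ *ᵥ y) = 0 := by
    rw [dotProduct_mulVec, ← mulVec_transpose, transpose_transpose, mulVec_mulVec,
      ← laplacian, h, zero_dotProduct]
  have h2 := dotProduct_self_eq_zero.1 h1
  refine eq_of_forall_src_eq_tgt o hG (fun e ↦ ?_) u v
  rw [← sub_eq_zero, ← boundary_transpose_mulVec, h2, Pi.zero_apply]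

/-- Constants are in the kernel of `L`, so `z` may be normalised to vanish at `v`; column `v` then
contributes nothing. -/
theorem laplacian_mulVec_apply (v : V(G)) (z : Div G) (u : {u : V(G) // u ≠ v}) :
    (laplacian o *ᵥ z) u = (reducedLaplacian o v *ᵥ fun w ↦ z w - z v) u := by
  have h : laplacian o *ᵥ z = laplacian o *ᵥ (z - z v • 1) := by
    rw [mulVec_sub, mulVec_smul, laplacian_mulVec_one, smul_zero, sub_zero]
  rw [h, mulVec, dotProduct, Fintype.sum_eq_add_sum_subtype_ne _ v]
  simp [mulVec, dotProduct, reducedLaplacian]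

theorem det_reducedLaplacian_ne_zero (hG : IsConnected G) (v : V(G)) :
    (reducedLaplacian o v).det ≠ 0 := by
  intro hdet
  obtain ⟨y, hy, hLy⟩ := exists_mulVec_eq_zero_iff.2 hdet
  let z : Div G := fun u ↦ if h : u ≠ v then y ⟨u, h⟩ else 0
  have hzv : z v = 0 := by simp [z]
  have hz : ∀ u : {u : V(G) // u ≠ v}, z u = y u := fun u ↦ by simp [z, u.2]
  have hLz : laplacian o *ᵥ z = 0 := by
    refine eq_of_deg_eq v (by simp [deg_laplacian]) fun u ↦ ?_
    rw [laplacian_mulVec_apply]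
    simp [hzv, hz, hLy]
  apply hy
  ext u
  rw [← hz, eq_of_laplacian_mulVec_eq_zero o hG hLz u v, hzv, Pi.zero_apply]

theorem nat_card_torsion_jac (hG : IsConnected G) (v : V(G)) :
    Nat.card (AddCommGroup.torsion (Jac o)) = (reducedLaplacian o v).det.natAbs := by
  have hdet := det_reducedLaplacian_ne_zero o hG v
  let Φ : ({u : V(G) // u ≠ v} → ℤ) →+ Jac o :=
    ((Prin o).mkQ ∘ₗ extendDegZero v).toAddMonoidHom
  have hΦ (x) : Φ x = 0 ↔ x ∈ LinearMap.range (reducedLaplacian o v).mulVecLin := by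
    refine (Submodule.Quotient.mk_eq_zero (Prin o)).trans ⟨?_, ?_⟩
    · rintro ⟨z, hz⟩
      refine ⟨fun w ↦ z w - z v, ?_⟩
      ext u
      rw [mulVecLin_apply, ← laplacian_mulVec_apply, ← mulVecLin_apply, hz, extendDegZero_apply]
    · rintro ⟨y, rfl⟩
      let z : Div G := fun u ↦ if h : u ≠ v then y ⟨u, h⟩ else 0
      have hzv : z v = 0 := by simp [z]
      have hz : ∀ u : {u : V(G) // u ≠ v}, z u = y u := fun u ↦ by simp [z, u.2]
      refine ⟨z, eq_of_deg_eq v ?_ fun u ↦ ?_⟩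
      · rw [deg_extendDegZero, mulVecLin_apply, deg_laplacian]
      · rw [extendDegZero_apply, mulVecLin_apply, laplacian_mulVec_apply]
        simp [hzv, hz]
  have hrange : Φ.range = AddCommGroup.torsion (Jac o) := by
    ext D
    constructor
    · rintro ⟨x, rfl⟩
      -- The determinant annihilates the cokernel, by `M * adj M = det M`.
      refine isOfFinAddOrder_iff_zsmul_eq_zero.2 ⟨_, hdet, ?_⟩
      rw [← map_zsmul, hΦ]
      exact ⟨(reducedLaplacian o v).adjugate *ᵥ x, by
        rw [mulVecLin_apply, mulVec_mulVec, mul_adjugate, smul_mulVec, one_mulVec]⟩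
    · intro hD
      obtain ⟨k, hk, hD⟩ := isOfFinAddOrder_iff_zsmul_eq_zero.1 hD
      obtain ⟨D, rfl⟩ := (Prin o).mkQ_surjective D
      rw [← map_zsmul] at hD
      obtain ⟨z, hz⟩ := (Submodule.Quotient.mk_eq_zero (Prin o)).1 hD
      have hdeg : deg G D = 0 := by
        have h : k • deg G D = 0 := by rw [← map_zsmul, ← hz, mulVecLin_apply, deg_laplacian]
        simpa [hk] using h
      refine ⟨fun u ↦ D u, congrArg (Prin o).mkQ (eq_of_deg_eq v ?_ fun u ↦ ?_)⟩
      · rw [deg_extendDegZero, hdeg]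
      · rw [extendDegZero_apply]
  have hker : (LinearMap.range (reducedLaplacian o v).mulVecLin).toAddSubgroup = Φ.ker := by
    ext x
    exact (hΦ x).symm
  rw [← nat_card_quotient_range_mulVecLin _ hdet]
  exact Nat.card_congr (((QuotientAddGroup.quotientAddEquivOfEq hker).trans
    (QuotientAddGroup.quotientKerEquivRange Φ)).trans
      (AddEquiv.addSubgroupCongr hrange)).toEquiv.symm

theorem adjugate_laplacian_apply_self (v : V(G)) :
    (laplacian o).adjugate v v = (reducedLaplacian o v).det := by
  rw [adjugate_apply, twoBlockTriangular_det _ (fun u ↦ u ≠ v)]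
  · have h : toSquareBlockProp ((laplacian o).updateRow v (Pi.single v 1)) (fun u ↦ u ≠ v) =
        reducedLaplacian o v := by
      ext i j
      simp [toSquareBlockProp, reducedLaplacian, updateRow_ne i.2]
    have : Subsingleton {u : V(G) // ¬u ≠ v} :=
      ⟨fun a b ↦ Subtype.ext ((not_not.1 a.2).trans (not_not.1 b.2).symm)⟩
    have h1 : (toSquareBlockProp ((laplacian o).updateRow v (Pi.single v 1))
        (fun u ↦ ¬u ≠ v)).det = 1 := by
      rw [det_eq_elem_of_subsingleton _ ⟨v, fun h ↦ h rfl⟩]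
      simp [toSquareBlockProp]
    rw [h, h1, mul_one]
  · intro i hi j hj
    obtain rfl := not_not.1 hi
    simp [hj]

/-- `L * adj L = det L = 0` puts the columns of the adjugate in `ker L`, so they are constant;
symmetry of `L` makes the rows constant too. -/
theorem adjugate_laplacian_apply (hG : IsConnected G) (u v w : V(G)) :
    (laplacian o).adjugate u v = (reducedLaplacian o w).det := by
  have hdet : (laplacian o).det = 0 :=
    exists_mulVec_eq_zero_iff.1 ⟨1, fun h ↦ one_ne_zero (congrFun h w), laplacian_mulVec_one o⟩
  have hsymm : ∀ u v, (laplacian o).adjugate u v = (laplacian o).adjugate v u := fun u v ↦ by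
    conv_lhs => rw [← isSymm_laplacian o, ← adjugate_transpose, transpose_apply]
  have hcol : ∀ u u' v, (laplacian o).adjugate u v = (laplacian o).adjugate u' v := fun u u' v ↦ by
    refine eq_of_laplacian_mulVec_eq_zero o hG (y := fun u ↦ (laplacian o).adjugate u v) ?_ u u'
    ext i
    have h := congrFun (congrFun (mul_adjugate (laplacian o)) i) v
    rw [hdet, zero_smul] at h
    exact h
  rw [hcol u w, hsymm, hcol v w, adjugate_laplacian_apply_self]

end GraphJacobian

/-! ### The Cauchy-Binet formula -/

namespace Matrix

variable {m n R : Type*} [Fintype m] [DecidableEq m] [Fintype n] [CommRing R]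

theorem det_mul_eq_sum_pi (A : Matrix m n R) (B : Matrix n m R) :
    (A * B).det = ∑ f : m → n, (∏ i, A i (f i)) * (B.submatrix f id).det := by
  classical
  have h : A * B = fun i ↦ ∑ k, A i k • B k := by
    ext i j
    simp [mul_apply]
  have h2 := (detRowAlternating (n := m) (R := R)).toMultilinearMap.map_sum
    (fun i (k : n) ↦ A i k • B k)
  rw [h]
  refine h2.trans (Finset.sum_congr rfl fun f _ ↦ ?_)
  rw [MultilinearMap.map_smul_univ, smul_eq_mul]
  rfl

/-- The Cauchy-Binet formula. -/
theorem det_mul_eq_sum_det_mul_det [DecidableEq n] (A : Matrix m n R) (B : Matrix n m R)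
    (e : ∀ S : {S : Finset n // S.card = Fintype.card m}, m ≃ S.1) :
    (A * B).det = ∑ S : {S : Finset n // S.card = Fintype.card m},
      (A.submatrix id fun i ↦ (e S i : n)).det * (B.submatrix (fun i ↦ (e S i : n)) id).det := by
  rw [det_mul_eq_sum_pi]
  -- `F` parametrises the injective maps `m → n` by their image and a permutation. The other maps
  -- repeat a row of `B` and contribute zero.
  let F : (Σ _ : {S : Finset n // S.card = Fintype.card m}, Equiv.Perm m) → (m → n) :=
    fun x i ↦ e x.1 (x.2 i)
  have himage (x) : Finset.univ.image (F x) = x.1.1 := by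
    ext k
    simp only [Finset.mem_image, Finset.mem_univ, true_and, F]
    refine ⟨?_, fun hk ↦ ⟨x.2.symm ((e x.1).symm ⟨k, hk⟩), by simp⟩⟩
    rintro ⟨i, rfl⟩
    exact (e x.1 (x.2 i)).2
  have hF : Function.Injective F := by
    rintro ⟨S, σ⟩ ⟨T, τ⟩ h
    obtain rfl : S = T := Subtype.ext (by rw [← himage ⟨S, σ⟩, h, himage])
    obtain rfl : σ = τ := Equiv.ext fun i ↦
      (e S).injective (Subtype.ext (congrFun h i))
    rfl
  rw [← Fintype.sum_of_injective F hF (fun x ↦ (∏ i, A i (F x i)) * (B.submatrix (F x) id).det) _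
    (fun f hf ↦ ?_) fun _ ↦ rfl]
  · rw [Fintype.sum_sigma]
    refine Fintype.sum_congr _ _ fun S ↦ ?_
    rw [← det_transpose, det_apply', Finset.sum_mul]
    refine Fintype.sum_congr _ _ fun σ ↦ ?_
    have h : B.submatrix (F ⟨S, σ⟩) id = (B.submatrix (fun i ↦ (e S i : n)) id).submatrix σ id := rfl
    rw [h, det_permute]
    simp only [transpose_apply, submatrix_apply, id, F]
    ring
  · by_cases hinj : Function.Injective f
    · refine (hf ?_).elim
      let S : {S : Finset n // S.card = Fintype.card m} :=
        ⟨Finset.univ.image f, Finset.card_image_of_injective _ hinj⟩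
      let g : m → m := fun i ↦ (e S).symm ⟨f i, Finset.mem_image_of_mem _ (Finset.mem_univ i)⟩
      have hg : Function.Injective g := fun i j hij ↦
        hinj (Subtype.ext_iff.1 ((e S).symm.injective hij))
      exact ⟨⟨S, Equiv.ofBijective g (Finite.injective_iff_bijective.1 hg)⟩, funext fun i ↦ by
        simp [F, g]⟩
    · obtain ⟨i, j, hij, hne⟩ := Function.not_injective_iff.1 hinj
      rw [det_zero_of_row_eq hne (by ext; simp [hij]), mul_zero]

end Matrix

/-! ### Spanning trees as sets of edges -/

namespace GraphJacobian

/-- Choosing an edge of `T` above each edge of the simple graph gives an injection `φ`.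
Connectedness gives `|V| ≤ |E(simple)| + 1 ≤ |E(T)| + 1`; equality forces `φ` to be surjective,
which excludes loops and parallel edges. -/
theorem isTree_iff_connected_and_card {α β : Type} (T : Graph α β) [Finite V(T)] [Finite E(T)] :
    IsTree T ↔ IsConnected T ∧ Nat.card E(T) + 1 = Nat.card V(T) := by
  have hex (s : T.toSimpleGraph.edgeSet) :
      ∃ e : E(T), ∀ x y : V(T), s.1 = s(x, y) → T.IsLink (e : β) (x : α) (y : α) := by
    obtain ⟨s, hs⟩ := s
    induction s with | _ x y
    obtain ⟨-, e, he⟩ := hs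
    refine ⟨⟨e, he.edge_mem⟩, fun x' y' h ↦ ?_⟩
    obtain ⟨rfl, rfl⟩ | ⟨rfl, rfl⟩ := Sym2.eq_iff.1 h
    exacts [he, he.symm]
  choose φ hφ using hex
  have hinj : Function.Injective φ := by
    rintro ⟨s, hs⟩ ⟨t, ht⟩ h
    induction s with | _ x y
    induction t with | _ x' y'
    have h1 := hφ ⟨_, hs⟩ x y rfl
    have h2 := hφ ⟨_, ht⟩ x' y' rfl
    rw [h] at h1
    refine Subtype.ext (Sym2.eq_iff.2 ?_)
    simpa only [Subtype.ext_iff] using h1.eq_and_eq_or_eq_and_eq h2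
  constructor
  · rintro ⟨hs, ht⟩
    have hsurj : Function.Surjective φ := by
      rintro ⟨e, he⟩
      obtain ⟨x, y, hxy⟩ := T.exists_isLink_of_mem_edgeSet he
      let s : T.toSimpleGraph.edgeSet := ⟨s(⟨x, hxy.left_mem⟩, ⟨y, hxy.right_mem⟩),
        fun h ↦ hxy.ne (congrArg Subtype.val h), e, hxy⟩
      exact ⟨s, Subtype.ext ((hφ s _ _ rfl).eq hxy)⟩
    rw [← Nat.card_congr (Equiv.ofBijective φ ⟨hinj, hsurj⟩)]
    exact SimpleGraph.isTree_iff_connected_and_card.1 ht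
  · rintro ⟨hc, hcard⟩
    have h1 : Nat.card V(T) ≤ Nat.card T.toSimpleGraph.edgeSet + 1 :=
      SimpleGraph.Connected.card_vert_le_card_edgeSet_add_one hc
    have h2 : Nat.card T.toSimpleGraph.edgeSet ≤ Nat.card E(T) :=
      Nat.card_le_card_of_injective φ hinj
    have h3 : Nat.card T.toSimpleGraph.edgeSet = Nat.card E(T) := by lia
    have hsurj : Function.Surjective φ :=
      ((Nat.bijective_iff_injective_and_card φ).2 ⟨hinj, h3⟩).2
    refine ⟨?_, SimpleGraph.isTree_iff_connected_and_card.2 ⟨hc, by lia⟩⟩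
    have key {e x y} (he : T.IsLink e x y) : ∃ s : T.toSimpleGraph.edgeSet, (φ s : β) = e ∧
        s.1 = s(⟨x, he.left_mem⟩, ⟨y, he.right_mem⟩) := by
      obtain ⟨⟨s, hs⟩, h⟩ := hsurj ⟨e, he.edge_mem⟩
      induction s with | _ u v
      have h4 := hφ ⟨_, hs⟩ u v rfl
      rw [h] at h4
      refine ⟨⟨_, hs⟩, by rw [h], Sym2.eq_iff.2 ?_⟩
      simpa only [Subtype.ext_iff] using h4.eq_and_eq_or_eq_and_eq he
    refine { not_isLoopAt := fun e x h ↦ ?_, eq_of_isLink := fun e f x y he hf ↦ ?_ }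
    · obtain ⟨⟨s, hs⟩, -, h⟩ := key (Graph.isLink_self_iff.2 h)
      subst h
      exact hs.1 rfl
    · obtain ⟨s, rfl, hs⟩ := key he
      obtain ⟨t, rfl, ht⟩ := key hf
      rw [Subtype.ext (hs.trans ht.symm)]

/-- The spanning subgraph of `G` with a given set of edges. -/
def spanningSubgraph {α β : Type} {G : Graph α β} (S : Finset E(G)) : Graph α β :=
  G.restrict (Subtype.val '' (S : Set E(G)))

section

variable {α β : Type} {G : Graph α β}

theorem edgeSet_spanningSubgraph (S : Finset E(G)) :
    E(spanningSubgraph S) = Subtype.val '' (S : Set E(G)) := by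
  simp [spanningSubgraph]

theorem spanningSubgraph_isSpanningSubgraph (S : Finset E(G)) :
    (spanningSubgraph S).IsSpanningSubgraph G :=
  ⟨Graph.restrict_le, rfl⟩

theorem nat_card_edgeSet_spanningSubgraph (S : Finset E(G)) :
    Nat.card E(spanningSubgraph S) = S.card := by
  rw [edgeSet_spanningSubgraph, Nat.card_image_of_injective Subtype.val_injective]
  simp

/-- The underlying simple graph of a spanning subgraph, on the vertices of `G`. -/
def spanningSimpleGraph (S : Finset E(G)) : SimpleGraph V(G) :=
  (spanningSubgraph S).toSimpleGraph

theorem exists_isLink_of_spanningSimpleGraph_adj {S : Finset E(G)} {u v : V(G)}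
    (h : (spanningSimpleGraph S).Adj u v) : ∃ e ∈ S, G.IsLink (e : β) (u : α) (v : α) := by
  obtain ⟨-, e, ⟨e, he, rfl⟩, hl⟩ := h
  exact ⟨e, he, hl⟩

theorem reachable_of_mem {S : Finset E(G)} {u v : V(G)} {e : E(G)} (he : e ∈ S)
    (hl : G.IsLink (e : β) (u : α) (v : α)) : (spanningSimpleGraph S).Reachable u v := by
  by_cases h : u = v
  · rw [h]
  · exact SimpleGraph.Adj.reachable ⟨h, e, ⟨e, he, rfl⟩, hl⟩

theorem isTree_spanningSubgraph_iff [Finite V(G)] (S : Finset E(G)) :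
    IsTree (spanningSubgraph S) ↔
      (spanningSimpleGraph S).Connected ∧ S.card + 1 = Nat.card V(G) := by
  have : Finite V(spanningSubgraph S) := inferInstanceAs (Finite V(G))
  have : Finite E(spanningSubgraph S) := by
    rw [edgeSet_spanningSubgraph]
    exact (S.finite_toSet.image _).to_subtype
  rw [isTree_iff_connected_and_card, nat_card_edgeSet_spanningSubgraph]
  rfl

theorem numSpanningTrees_eq_card [Finite V(G)] [Finite E(G)] :
    numSpanningTrees G = Nat.card {S : Finset E(G) //
      (spanningSimpleGraph S).Connected ∧ S.card + 1 = Nat.card V(G)} := by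
  symm
  refine Nat.card_congr (Equiv.ofBijective (fun S ↦ ⟨spanningSubgraph S.1,
    spanningSubgraph_isSpanningSubgraph S.1, (isTree_spanningSubgraph_iff S.1).2 S.2⟩) ⟨?_, ?_⟩)
  · rintro ⟨S, _⟩ ⟨S', _⟩ h
    have h1 : E(spanningSubgraph S) = E(spanningSubgraph S') :=
      congrArg (fun T ↦ E(T.1)) h
    rw [edgeSet_spanningSubgraph, edgeSet_spanningSubgraph] at h1
    exact Subtype.ext (Finset.coe_injective (Subtype.val_injective.image_injective h1))
  · rintro ⟨T, hT, hT'⟩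
    let S : Finset E(G) := (Set.toFinite (Subtype.val ⁻¹' E(T))).toFinset
    have hS : spanningSubgraph S = T := by
      refine (Graph.Compatible.of_le_le (spanningSubgraph_isSpanningSubgraph S).le hT.le).ext
        hT.vertexSet_eq.symm ?_
      have h := hT.le.edgeSet_mono
      rw [edgeSet_spanningSubgraph]
      simpa [S, Subtype.image_preimage_val] using h
    exact ⟨⟨S, (isTree_spanningSubgraph_iff S).1 (hS ▸ hT')⟩, Subtype.ext hS⟩

end

/-! ### Minors of the boundary matrix and the matrix-tree theorem -/

section Minor

open Matrix

variable {α β : Type} [DecidableEq α] {G : Graph α β} [Fintype V(G)]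
  (o : Orientation G) {v : V(G)} {S : Finset E(G)} (f : {u : V(G) // u ≠ v} ≃ S)

theorem det_boundary_minor_eq_zero (hS : ¬(spanningSimpleGraph S).Connected) :
    ((boundary o).submatrix (Subtype.val : {u : V(G) // u ≠ v} → V(G)) fun i ↦ (f i : E(G))).det =
      0 := by
  classical
  have hw : ∃ w, ¬(spanningSimpleGraph S).Reachable v w := by
    by_contra! h
    exact hS (SimpleGraph.connected_iff_exists_forall_reachable _ |>.2 ⟨v, h⟩)
  obtain ⟨w, hw⟩ := hw
  -- The indicator of the vertices not reachable from `v` is constant along the edges of `S`. As it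
  -- vanishes at `v`, its restriction is a nonzero left kernel vector of the minor.
  let y : Div G := fun u ↦ if (spanningSimpleGraph S).Reachable v u then 0 else 1
  have hyv : y v = 0 := if_pos (SimpleGraph.Reachable.refl v)
  have hwv : w ≠ v := by
    rintro rfl
    exact hw (SimpleGraph.Reachable.refl w)
  refine exists_vecMul_eq_zero_iff.1 ⟨fun u ↦ y u, fun h ↦ ?_, ?_⟩
  · have h1 : y w = 0 := congrFun h ⟨w, hwv⟩
    simp [y, hw] at h1
  · ext i
    have h1 := boundary_transpose_mulVec o y (f i)
    rw [mulVec, dotProduct, Fintype.sum_eq_add_sum_subtype_ne _ v, hyv, mul_zero, zero_add] at h1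
    have h2 : y (o.tgt (f i)) = y (o.src (f i)) := by
      have h := reachable_of_mem (f i).2 (o.isLink (f i))
      have h3 : (spanningSimpleGraph S).Reachable v (o.tgt (f i)) ↔
          (spanningSimpleGraph S).Reachable v (o.src (f i)) :=
        ⟨fun h' ↦ h'.trans h.symm, fun h' ↦ h'.trans h⟩
      simp only [y, h3]
    rw [h2, sub_self] at h1
    rw [Pi.zero_apply, ← h1]
    exact Finset.sum_congr rfl fun u _ ↦ mul_comm _ _

/-- The signed sum of the edges of a walk has telescoping boundary; the sign records whether an edge
is traversed along its orientation. -/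
theorem exists_boundary_mulVec_eq {u w : V(G)} (h : (spanningSimpleGraph S).Reachable u w) :
    ∃ x : {u : V(G) // u ≠ v} → ℤ,
      (boundary o).submatrix id (fun i ↦ (f i : E(G))) *ᵥ x = Pi.single w 1 - Pi.single u 1 := by
  obtain ⟨p⟩ := h
  induction p with
  | nil => exact ⟨0, by simp⟩
  | @cons a b c hadj _ ih =>
    obtain ⟨x, hx⟩ := ih
    obtain ⟨e, he, hl⟩ := exists_isLink_of_spanningSimpleGraph_adj hadj
    have hcol : (boundary o).submatrix id (fun i ↦ (f i : E(G))) *ᵥ Pi.single (f.symm ⟨e, he⟩) 1 =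
        Pi.single (o.tgt e) 1 - Pi.single (o.src e) 1 := by
      ext u
      simp [boundary, Pi.single_apply, eq_comm]
    obtain ⟨h1, h2⟩ | ⟨h1, h2⟩ := (o.isLink e).eq_and_eq_or_eq_and_eq hl
    · refine ⟨x + Pi.single (f.symm ⟨e, he⟩) 1, ?_⟩
      rw [mulVec_add, hx, hcol, Subtype.ext h1, Subtype.ext h2]
      abel
    · refine ⟨x - Pi.single (f.symm ⟨e, he⟩) 1, ?_⟩
      rw [mulVec_sub, hx, hcol, Subtype.ext h1, Subtype.ext h2]
      abel

/-- Walks from `v` to each `w` are the columns of an integral right inverse, because the term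
`Pi.single v 1` disappears with row `v`. -/
theorem isUnit_det_boundary_minor (hS : (spanningSimpleGraph S).Connected) :
    IsUnit ((boundary o).submatrix (Subtype.val : {u : V(G) // u ≠ v} → V(G))
      fun i ↦ (f i : E(G))).det := by
  choose x hx using fun w ↦ exists_boundary_mulVec_eq o f (hS.preconnected v w)
  refine isUnit_det_of_right_inverse (B := of fun i u ↦ x u i) ?_
  ext u w
  have h := congrFun (hx w) u
  simp only [Pi.sub_apply, Pi.single_apply, if_neg u.2, sub_zero] at h
  exact h.trans (if_congr Subtype.ext_iff.symm rfl rfl)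

/-- The matrix-tree theorem. -/
theorem det_reducedLaplacian [Fintype E(G)] (v : V(G)) :
    (reducedLaplacian o v).det = numSpanningTrees G := by
  classical
  have hcard : Fintype.card {u : V(G) // u ≠ v} + 1 = Nat.card V(G) := by
    rw [Nat.card_eq_fintype_card, Fintype.card_subtype_compl, Fintype.card_subtype_eq]
    have := Fintype.card_pos_iff.2 ⟨v⟩
    lia
  let f (S : {S : Finset E(G) // S.card = Fintype.card {u : V(G) // u ≠ v}}) :
      {u : V(G) // u ≠ v} ≃ S.1 := Fintype.equivOfCardEq (by simp [S.2])
  let A := (boundary o).submatrix (Subtype.val : {u : V(G) // u ≠ v} → V(G)) id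
  have hA : reducedLaplacian o v = A * Aᵀ := rfl
  have hterm (S) : (A.submatrix id fun i ↦ (f S i : E(G))).det *
      (Aᵀ.submatrix (fun i ↦ (f S i : E(G))) id).det =
        if (spanningSimpleGraph S.1).Connected then 1 else 0 := by
    -- Each Cauchy-Binet term is the square of a minor, so the signs of the minors and the choice of
    -- `f` do not matter.
    rw [← transpose_submatrix, det_transpose]
    split_ifs with h
    · exact Int.isUnit_mul_self (isUnit_det_boundary_minor o (f S) h)
    · have h0 : (A.submatrix id fun i ↦ (f S i : E(G))).det = 0 :=
        det_boundary_minor_eq_zero o (f S) h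
      rw [h0, zero_mul]
  rw [hA, det_mul_eq_sum_det_mul_det A Aᵀ f, Fintype.sum_congr _ _ hterm, Finset.sum_boole,
    numSpanningTrees_eq_card, ← Fintype.card_subtype, ← Nat.card_eq_fintype_card]
  congr 1
  refine Nat.card_congr ((Equiv.subtypeSubtypeEquivSubtypeInter
    (fun S : Finset E(G) ↦ S.card = Fintype.card {u : V(G) // u ≠ v})
    (fun S ↦ (spanningSimpleGraph S).Connected)).trans
    (Equiv.subtypeEquivRight fun S ↦ ?_))
  rw [and_comm, ← hcard, add_left_inj]

end Minor

end GraphJacobian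

theorem mainTheorem4 {α β : Type} [DecidableEq α] (G : Graph α β) [Fintype V(G)] [Fintype E(G)]
    (hG : GraphJacobian.IsConnected G) (o : GraphJacobian.Orientation G)
    (R : InjectiveResolution (ModuleCat.of ℤ ℤ)) :
    Nonempty
      ((GraphJacobian.derivedDual R (GraphJacobian.divisorComplex o)).homology 1 ≃+
        AddCommGroup.torsion (GraphJacobian.Jac o)) ∧
    Nat.card ((GraphJacobian.derivedDual R (GraphJacobian.divisorComplex o)).homology 1) =
      GraphJacobian.numSpanningTrees G ∧
    Nat.card (AddCommGroup.torsion (GraphJacobian.Jac o)) = GraphJacobian.numSpanningTrees G ∧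
    Nat.card (AddCommGroup.torsion
      ((V(G) → ℤ) ⧸ LinearMap.range (GraphJacobian.laplacian o).mulVecLin)) =
      GraphJacobian.numSpanningTrees G ∧
    (∀ v : V(G), (GraphJacobian.reducedLaplacian o v).det =
      (GraphJacobian.numSpanningTrees G : ℤ)) ∧
    (∀ u v : V(G), (GraphJacobian.laplacian o).adjugate u v =
      (GraphJacobian.numSpanningTrees G : ℤ)) := by
  obtain ⟨e⟩ := GraphJacobian.nonempty_homology_derivedDual_equiv o R
  obtain ⟨v⟩ := hG.nonempty
  have htors : Nat.card (AddCommGroup.torsion (GraphJacobian.Jac o)) =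
      GraphJacobian.numSpanningTrees G := by
    rw [GraphJacobian.nat_card_torsion_jac o hG v, GraphJacobian.det_reducedLaplacian,
      Int.natAbs_natCast]
  exact ⟨⟨e⟩, (Nat.card_congr e.toEquiv).trans htors, htors, htors,
    GraphJacobian.det_reducedLaplacian o, fun u w ↦ by
      rw [GraphJacobian.adjugate_laplacian_apply o hG u w v,
        GraphJacobian.det_reducedLaplacian]⟩
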